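/- **Conventions.** A *solution* $(X,r)$ is a nonempty set $X$ of arbitrary cardinality with a map $r\colon X\times X\to X\times X$, $r(x,y)=({}^xy,x^y)$, such that $r^2=\mathrm{id}$, the maps $\mathcal L_x\colon y\mapsto {}^xy$ and $\mathcal R_y\colon x\mapsto x^y$ are bijective for all $x,y\in X$, and the braid relation $r^{12}r^{23}r^{12}=r^{23}r^{12}r^{23}$ holds on $X^3$, where $r^{12}=r\times\mathrm{id}_X$ and $r^{23}=\mathrm{id}_X\times r$. It is *square-free* if $r(x,x)=(x,x)$ for all $x$, and *nontrivial* if $r$ is not the flip $(x,y)\mapsto(y,x)$ (so $|X|\ge 2$). It satisfies **lri** if $({}^xy)^x=y={}^x(y^x)$ for all $x,y$. Its retraction $\mathrm{Ret}(X,r)$ is the solution induced by $r$ on $X/{\sim}$, where $x\sim y$ iff $\mathcal L_x=\mathcal L_y$; moreover $\mathrm{Ret}^0(X,r)=(X,r)$ and $\mathrm{Ret}^{n+1}(X,r)=\mathrm{Ret}(\mathrm{Ret}^{n}(X,r))$. We write $\mathrm{mpl}(X,r)=m$ if $m$ is the least integer $\ge 0$ such that $\mathrm{Ret}^m(X,r)$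 has exactly one element. A *symmetric group* (in the sense of Takeuchi) is a group $G$ with an involutive map $\sigma(a,b)=({}^ab,a^b)$ on $G\times G$ such that for all $a,b,u,v \in G$: ${}^a1=1$, ${}^1u=u$, $1^u=1$, $a^1=a$, ${}^{ab}u={}^a({}^bu)$, $a^{uv}=(a^u)^v$, ${}^a(uv)=({}^au)({}^{a^u}v)$, $(ab)^u=(a^{{}^bu})(b^u)$ and $uv=({}^uv)(u^v)$. Then $(G,\sigma)$ is a solution, and $a+b:=a\,({}^{a^{-1}}b)$ makes $G$ a left brace, called its associated left brace: $(G,+)$ is an abelian group, and $a(b+c)+a=ab+ac$. For a solution $(X,r)$ let $G(X,r)$ be the group with generators $X$ and relations $xy=({}^xy)(x^y)$, $x,y\in X$, and let $r_G$ be the unique map for which $(G(X,r),r_G)$ is a symmetric group and $r_G$ is compatible with $r$ under the canonical map $X\to G(X,r)$. **Theorem.** Let $(X,r)$ be a nontrivial square-free solution of arbitrary cardinality, and let $(G,r_G)$, $G=G(X,r)$, be its symmetric group. (1) The following conditions are equivalent. - (a) $\mathrm{mpl}(X,r)=2$. - (b) $\mathrm{mpl}(G,r_G)=2$. - (c) $G$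 acts upon itself as automorphisms: ${}^a(bc)=({}^ab)({}^ac)$ for all $a,b,c\in G$. - (c$'$) $\mathcal L_{({}^ba)}=\mathcal L_a$ for all $a,b\in G$, where $\mathcal L_a\colon G\to G$, $c\mapsto{}^ac$. - (d) The solution $(G,r_G)$ satisfies **lri**. - (e) The left brace associated to $(G,r_G)$ satisfies **Raut**: $(a+b)^c=a^c+b^c$ for all $a,b,c\in G$. (2) For every integer $m\ge 2$: $\mathrm{mpl}(X,r)=m$ if and only if the derived symmetric group $G_{m-2}=G(\mathrm{Ret}^{m-2}(X,r))$, with its map $r_{G_{m-2}}$, is nonabelian and satisfies **lri**. -/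

import Mathlib

universe u

namespace YBE

theorem apply_inv_perm {A : Type*} (f : Equiv.Perm A) (a : A) : f (f⁻¹ a) = a :=
  f.apply_symm_apply a

theorem inv_apply_perm {A : Type*} (f : Equiv.Perm A) (a : A) : f⁻¹ (f a) = a :=
  f.symm_apply_apply a

/-- `r × id` on `X × X × X`. -/
def r12 {X : Type*} (r : X × X → X × X) : X × X × X → X × X × X :=
  fun p => ((r (p.1, p.2.1)).1, (r (p.1, p.2.1)).2, p.2.2)

/-- `id × r` on `X × X × X`. -/
def r23 {X : Type*} (r : X × X → X × X) : X × X × X → X × X × X :=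
  fun p => (p.1, r (p.2.1, p.2.2))

/-- A solution: a non-degenerate involutive set-theoretic solution `(X, r)` of the Yang-Baxter
equation (a non-degenerate symmetric set) on a nonempty set of arbitrary cardinality. -/
structure Solution where
  carrier : Type u
  nonempty : Nonempty carrier
  r : carrier × carrier → carrier × carrier
  involutive : Function.Involutive r
  left_bijective : ∀ x, Function.Bijective fun y => (r (x, y)).1
  right_bijective : ∀ y, Function.Bijective fun x => (r (x, y)).2
  braid : r12 r ∘ r23 r ∘ r12 r = r23 r ∘ r12 r ∘ r23 r

namespace Solution

variable (X : Solution.{u})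

/-- The left action `y ↦ ˣy`, where `r (x, y) = (ˣy, xʸ)`. -/
noncomputable def L (x : X.carrier) : Equiv.Perm X.carrier :=
  Equiv.ofBijective (fun y => (X.r (x, y)).1) (X.left_bijective x)

/-- The right action `x ↦ xʸ`, where `r (x, y) = (ˣy, xʸ)`. -/
noncomputable def R (y : X.carrier) : Equiv.Perm X.carrier :=
  Equiv.ofBijective (fun x => (X.r (x, y)).2) (X.right_bijective y)

/-- `(X, r)` is square-free. -/
def IsSquareFree : Prop := ∀ x, X.r (x, x) = (x, x)

/-- `r` is the flip map. -/
def IsTrivial : Prop := ∀ x y, X.r (x, y) = (y, x)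

/-- Condition **lri**: `(ˣy)ˣ = y = ˣ(yˣ)`. -/
def Lri : Prop := ∀ x y, X.R x (X.L x y) = y ∧ X.L x (X.R x y) = y

variable {X}

theorem r_eq (x y : X.carrier) : X.r (x, y) = (X.L x y, X.R y x) := rfl

theorem L_L_R (x y : X.carrier) : X.L (X.L x y) (X.R y x) = x :=
  congrArg Prod.fst (X.involutive (x, y))

theorem R_R_L (x y : X.carrier) : X.R (X.R y x) (X.L x y) = y :=
  congrArg Prod.snd (X.involutive (x, y))

theorem R_eq (x y : X.carrier) : X.R y x = (X.L (X.L x y))⁻¹ x := by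
  rw [Equiv.Perm.eq_inv_iff_eq, L_L_R]

theorem L_mul (x y : X.carrier) : X.L x * X.L y = X.L (X.L x y) * X.L (X.R y x) := by
  ext z
  have h := congrArg Prod.fst (congrFun X.braid (x, y, z))
  exact h.symm

theorem R_mul (y z : X.carrier) : X.R z * X.R y = X.R (X.R z y) * X.R (X.L y z) := by
  ext x
  have h := congrArg (fun p => p.2.2) (congrFun X.braid (x, y, z))
  exact h

/-- The map `x ↦ L_x⁻¹ x`. -/
noncomputable def T (X : Solution.{u}) : Equiv.Perm X.carrier where
  toFun x := (X.L x)⁻¹ x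
  invFun y := (X.R y)⁻¹ y
  left_inv x := by
    rw [Equiv.Perm.inv_eq_iff_eq]
    have h := R_eq x ((X.L x)⁻¹ x)
    rw [apply_inv_perm] at h
    exact h.symm
  right_inv y := by
    rw [Equiv.Perm.inv_eq_iff_eq]
    have h := L_L_R ((X.R y)⁻¹ y) y
    have h2 := R_R_L ((X.R y)⁻¹ y) y
    rw [apply_inv_perm] at h h2
    have h3 : X.L ((X.R y)⁻¹ y) y = (X.R y)⁻¹ y := by
      rw [Equiv.Perm.eq_inv_iff_eq, h2]
    exact h3.symm

theorem T_R (x y : X.carrier) : X.T (X.R y x) = (X.L y)⁻¹ (X.T x) := by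
  have h := L_mul x y
  have h2 : (X.L y)⁻¹ ((X.L x)⁻¹ x) = (X.L (X.R y x))⁻¹ ((X.L (X.L x y))⁻¹ x) := by
    rw [← Equiv.Perm.mul_apply, ← Equiv.Perm.mul_apply, ← mul_inv_rev, ← mul_inv_rev, h]
  change (X.L (X.R y x))⁻¹ (X.R y x) = (X.L y)⁻¹ ((X.L x)⁻¹ x)
  rw [h2, ← R_eq]

theorem R_eq_conj (y : X.carrier) : X.R y = X.T⁻¹ * (X.L y)⁻¹ * X.T := by
  ext x
  rw [Equiv.Perm.mul_apply, Equiv.Perm.mul_apply, Equiv.Perm.eq_inv_iff_eq, T_R]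

theorem R_eq_iff (x y : X.carrier) : X.R x = X.R y ↔ X.L x = X.L y := by
  rw [R_eq_conj, R_eq_conj, mul_left_inj, mul_right_inj, inv_inj]

/-- `x ∼ y` iff `L_x = L_y`. -/
noncomputable def retSetoid (X : Solution.{u}) : Setoid X.carrier := Setoid.comap X.L ⊥

theorem rel_iff {x y : X.carrier} : X.retSetoid x y ↔ X.L x = X.L y := Iff.rfl

theorem rel_L {x x' y y' : X.carrier} (hx : X.L x = X.L x') (hy : X.L y = X.L y') :
    X.L (X.L x y) = X.L (X.L x' y') := by
  have h1 := L_mul x' y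
  have h2 := L_mul x' y'
  rw [(R_eq_iff y y').2 hy, hy, h2] at h1
  rw [hx]
  exact (mul_right_cancel h1).symm

theorem rel_R {x x' y y' : X.carrier} (hx : X.L x = X.L x') (hy : X.L y = X.L y') :
    X.L (X.R y x) = X.L (X.R y' x') := by
  rw [(R_eq_iff y y').2 hy]
  have h1 := L_mul x y'
  have h2 := L_mul x' y'
  rw [hx, h2] at h1
  exact (mul_left_cancel h1).symm

theorem rel_of_L {x y y' : X.carrier} (h : X.L (X.L x y) = X.L (X.L x y')) :
    X.L y = X.L y' := by
  have h1 := L_mul x y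
  have h2 := L_mul x y'
  rw [R_eq, h] at h1
  rw [R_eq, ← h1] at h2
  exact (mul_left_cancel h2).symm

theorem rel_of_R {x x' y : X.carrier} (h : X.L (X.R y x) = X.L (X.R y x')) :
    X.L x = X.L x' := by
  rw [← R_eq_iff] at h ⊢
  have e : ∀ a, X.L a y = (X.R (X.R y a))⁻¹ y := fun a => by
    rw [Equiv.Perm.eq_inv_iff_eq, R_R_L]
  have h1 := R_mul x y
  have h2 := R_mul x' y
  rw [e, h] at h1
  rw [e, ← h1] at h2
  exact (mul_left_cancel h2).symm

/-- The map `r_[X] ([x], [y]) = ([ˣy], [xʸ])` on `[X] = X / ∼`. -/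
noncomputable def retMap (X : Solution.{u}) (p : Quotient X.retSetoid × Quotient X.retSetoid) :
    Quotient X.retSetoid × Quotient X.retSetoid :=
  Quotient.lift₂ (fun x y => ((⟦X.L x y⟧ : Quotient X.retSetoid),
      (⟦X.R y x⟧ : Quotient X.retSetoid)))
    (fun _ _ _ _ hx hy =>
      Prod.ext (Quotient.sound (rel_L hx hy)) (Quotient.sound (rel_R hx hy))) p.1 p.2

/-- The retraction `Ret(X, r) = ([X], r_[X])`. -/
noncomputable def Ret (X : Solution.{u}) : Solution.{u} where
  carrier := Quotient X.retSetoid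
  nonempty := X.nonempty.map (fun x => ⟦x⟧)
  r := X.retMap
  involutive := by
    rintro ⟨⟨x⟩, ⟨y⟩⟩
    exact Prod.ext (congrArg (Quotient.mk X.retSetoid) (L_L_R x y))
      (congrArg (Quotient.mk X.retSetoid) (R_R_L x y))
  left_bijective := by
    rintro ⟨x⟩
    constructor
    · rintro ⟨y⟩ ⟨y'⟩ h
      exact Quotient.sound (rel_of_L (Quotient.exact h))
    · rintro ⟨y⟩
      exact ⟨⟦(X.L x)⁻¹ y⟧,
        congrArg (Quotient.mk X.retSetoid) (apply_inv_perm (X.L x) y)⟩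
  right_bijective := by
    rintro ⟨y⟩
    constructor
    · rintro ⟨x⟩ ⟨x'⟩ h
      exact Quotient.sound (rel_of_R (Quotient.exact h))
    · rintro ⟨x⟩
      exact ⟨⟦(X.R y)⁻¹ x⟧,
        congrArg (Quotient.mk X.retSetoid) (apply_inv_perm (X.R y) x)⟩
  braid := by
    funext p
    obtain ⟨⟨x⟩, ⟨y⟩, ⟨z⟩⟩ := p
    exact congrArg (fun q : X.carrier × X.carrier × X.carrier =>
      (((⟦q.1⟧ : Quotient X.retSetoid), (⟦q.2.1⟧ : Quotient X.retSetoid),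
        (⟦q.2.2⟧ : Quotient X.retSetoid)))) (congrFun X.braid (x, y, z))

/-- `mpl(X, r) = m`: `m` is the least number such that `Ret^m(X, r)` is a one-element solution
(carriers of solutions are nonempty). -/
def HasMpl (X : Solution.{u}) (m : ℕ) : Prop :=
  IsLeast {n : ℕ | Subsingleton (Ret^[n] X).carrier} m

end Solution

/-- A left brace with multiplicative group `G`: an abelian group structure `+` on `G` such that
`a(b + c) + a = ab + ac`. -/
structure LeftBrace (G : Type*) [Group G] where
  addCommGroup : AddCommGroup G
  brace : ∀ a b c : G, a * (b + c) + a = a * b + a * c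

/-- A symmetric group in the sense of Takeuchi: a group `G` with an involutive braiding
operator `σ(a, b) = (ᵃb, aᵇ)`, i.e. `(G, G, σ)` is a matched pair of groups satisfying the
compatibility condition **M3**, and `σ` is involutive. -/
structure SymmetricGroup where
  carrier : Type u
  group : Group carrier
  σ : carrier × carrier → carrier × carrier
  ML0 : ∀ a u, (σ (a, 1)).1 = 1 ∧ (σ (1, u)).1 = u
  MR0 : ∀ a u, (σ (1, u)).2 = 1 ∧ (σ (a, 1)).2 = a
  ML1 : ∀ a b u, (σ (a * b, u)).1 = (σ (a, (σ (b, u)).1)).1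
  MR1 : ∀ a u v, (σ (a, u * v)).2 = (σ ((σ (a, u)).2, v)).2
  ML2 : ∀ a u v, (σ (a, u * v)).1 = (σ (a, u)).1 * (σ ((σ (a, u)).2, v)).1
  MR2 : ∀ a b u, (σ (a * b, u)).2 = (σ (a, (σ (b, u)).1)).2 * (σ (b, u)).2
  M3 : ∀ u v, u * v = (σ (u, v)).1 * (σ (u, v)).2
  involutive : Function.Involutive σ

namespace SymmetricGroup

variable (G : SymmetricGroup.{u})

instance instGroup : Group G.carrier := G.group

/-- The left action `ᵃb`. -/
def left (a b : G.carrier) : G.carrier := (G.σ (a, b)).1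

/-- The right action `aᵇ`. -/
def right (a b : G.carrier) : G.carrier := (G.σ (a, b)).2

variable {G}

theorem left_one (a : G.carrier) : G.left a 1 = 1 := (G.ML0 a 1).1

theorem one_left (u : G.carrier) : G.left 1 u = u := (G.ML0 1 u).2

theorem right_one (a : G.carrier) : G.right a 1 = a := (G.MR0 a 1).2

theorem left_mul (a b u : G.carrier) : G.left (a * b) u = G.left a (G.left b u) := G.ML1 a b u

theorem right_mul (a u v : G.carrier) : G.right a (u * v) = G.right (G.right a u) v :=
  G.MR1 a u v

theorem left_mul_left (a u v : G.carrier) :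
    G.left a (u * v) = G.left a u * G.left (G.right a u) v := G.ML2 a u v

theorem mul_eq (u v : G.carrier) : G.left u v * G.right u v = u * v := (G.M3 u v).symm

theorem left_inv_left (a u : G.carrier) : G.left a⁻¹ (G.left a u) = u := by
  rw [← left_mul, inv_mul_cancel, one_left]

theorem left_left_inv (a u : G.carrier) : G.left a (G.left a⁻¹ u) = u := by
  rw [← left_mul, mul_inv_cancel, one_left]

theorem left_left_right (u v : G.carrier) : G.left (G.left u v) (G.right u v) = u :=
  congrArg Prod.fst (G.involutive (u, v))

/-- Every symmetric group is a solution. -/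
def toSolution (G : SymmetricGroup.{u}) : Solution.{u} where
  carrier := G.carrier
  nonempty := ⟨1⟩
  r := G.σ
  involutive := G.involutive
  left_bijective a := ⟨Function.LeftInverse.injective (g := fun b => G.left a⁻¹ b)
      (left_inv_left a), Function.RightInverse.surjective (g := fun b => G.left a⁻¹ b)
      (left_left_inv a)⟩
  right_bijective b := by
    refine ⟨Function.LeftInverse.injective (g := fun a => G.right a b⁻¹) fun a => ?_,
      Function.RightInverse.surjective (g := fun a => G.right a b⁻¹) fun a => ?_⟩
    · change G.right (G.right a b) b⁻¹ = a
      rw [← right_mul, mul_inv_cancel, right_one]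
    · change G.right (G.right a b⁻¹) b = a
      rw [← right_mul, inv_mul_cancel, right_one]
  braid := by
    funext p
    obtain ⟨a, b, c⟩ := p
    have h1 : G.left (G.left a b) (G.left (G.right a b) c) = G.left a (G.left b c) := by
      rw [← left_mul, mul_eq, left_mul]
    have h3 : G.right (G.right a b) c = G.right (G.right a (G.left b c)) (G.right b c) := by
      rw [← right_mul, ← right_mul, mul_eq]
    have h2 : G.right (G.left a b) (G.left (G.right a b) c)
        = G.left (G.right a (G.left b c)) (G.right b c) := by
      have e1 : G.left (G.left a b) (G.left (G.right a b) c)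
          * G.right (G.left a b) (G.left (G.right a b) c) * G.right (G.right a b) c
          = a * b * c := by
        rw [mul_eq, mul_assoc, mul_eq, ← mul_assoc, mul_eq]
      have e2 : G.left a (G.left b c) * G.left (G.right a (G.left b c)) (G.right b c)
          * G.right (G.right a (G.left b c)) (G.right b c) = a * b * c := by
        rw [mul_assoc, mul_eq, ← mul_assoc, mul_eq, mul_assoc, mul_eq, mul_assoc]
      rw [← e2, h1, h3] at e1
      exact mul_left_cancel (mul_right_cancel e1)
    exact Prod.ext h1 (Prod.ext h2 h3)

/-- The sum `a + b = a (^{a⁻¹}b)` on a symmetric group. -/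
def add (a b : G.carrier) : G.carrier := a * G.left a⁻¹ b

theorem add_left (a b : G.carrier) : add a (G.left a b) = a * b := by
  rw [add, left_inv_left]

theorem add_comm' (a b : G.carrier) : add a b = add b a := by
  have h := left_left_right a (G.left a⁻¹ b)
  rw [left_left_inv] at h
  have h2 : G.right a (G.left a⁻¹ b) = G.left b⁻¹ a := by
    rw [← left_inv_left b (G.right a (G.left a⁻¹ b)), h]
  have h3 := mul_eq a (G.left a⁻¹ b)
  rw [left_left_inv, h2] at h3
  exact h3.symm

theorem left_add (a b c : G.carrier) :
    G.left a (add b c) = add (G.left a b) (G.left a c) := by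
  obtain ⟨d, rfl⟩ : ∃ d, c = G.left b d := ⟨G.left b⁻¹ c, (left_left_inv b c).symm⟩
  rw [add_left, left_mul_left, ← left_mul, ← mul_eq a b, left_mul, add_left]

theorem add_assoc' (a b c : G.carrier) : add (add a b) c = add a (add b c) := by
  rw [add, add, add, left_add, add, mul_inv_rev, left_mul, mul_assoc]

/-- The left brace associated to a symmetric group, with `a + b = a (^{a⁻¹}b)`. -/
def leftBrace (G : SymmetricGroup.{u}) : LeftBrace G.carrier where
  addCommGroup :=
    { add := add
      zero := 1
      neg := fun a => G.left a a⁻¹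
      add_assoc := add_assoc'
      add_comm := add_comm'
      zero_add := fun a => by
        change add 1 a = a
        rw [add, inv_one, one_left, one_mul]
      add_zero := fun a => by
        change add a 1 = a
        rw [add, left_one, mul_one]
      neg_add_cancel := fun a => by
        change add (G.left a a⁻¹) a = 1
        rw [add_comm', add_left, mul_inv_cancel]
      nsmul := @nsmulRec _ ⟨1⟩ ⟨add⟩
      zsmul := @zsmulRec _ ⟨1⟩ ⟨add⟩ ⟨fun a => G.left a a⁻¹⟩ (@nsmulRec _ ⟨1⟩ ⟨add⟩) }
  brace a b c := by
    change add (a * add b c) a = add (a * b) (a * c)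
    rw [← add_left a (add b c), left_add, ← add_left a b, ← add_left a c,
      add_comm' a (G.left a c), add_assoc', add_assoc', add_assoc']

/-- **MLaut**: `ᵃ(bc) = (ᵃb)(ᵃc)`, i.e. `G` acts upon itself as automorphisms. -/
def MLaut (G : SymmetricGroup.{u}) : Prop :=
  ∀ a b c : G.carrier, G.left a (b * c) = G.left a b * G.left a c

/-- **Raut**: `(a + b)ᶜ = aᶜ + bᶜ`, where `+` is the addition of the associated left brace. -/
def Raut (G : SymmetricGroup.{u}) : Prop :=
  letI := G.leftBrace.addCommGroup
  ∀ a b c : G.carrier, G.right (a + b) c = G.right a c + G.right b c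

end SymmetricGroup

namespace Solution

variable (X : Solution.{u})

/-- The YB group `G(X, r)`: generators `X`, relations `xy = zt` whenever `r(x, y) = (z, t)`. -/
def YBGroup : Type u :=
  PresentedGroup {w : FreeGroup X.carrier | ∃ x y z t, X.r (x, y) = (z, t) ∧
    w = FreeGroup.of x * FreeGroup.of y * (FreeGroup.of z * FreeGroup.of t)⁻¹}

instance : Group X.YBGroup := inferInstanceAs (Group (PresentedGroup _))

/-- The canonical map `X → G(X, r)`. -/
def ι (x : X.carrier) : X.YBGroup := PresentedGroup.of x

theorem ι_mul (x y : X.carrier) : X.ι x * X.ι y = X.ι (X.L x y) * X.ι (X.R y x) := by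
  have h : (PresentedGroup.mk {w : FreeGroup X.carrier | ∃ x y z t, X.r (x, y) = (z, t) ∧
      w = FreeGroup.of x * FreeGroup.of y * (FreeGroup.of z * FreeGroup.of t)⁻¹})
      (FreeGroup.of x * FreeGroup.of y
        * (FreeGroup.of (X.L x y) * FreeGroup.of (X.R y x))⁻¹) = 1 :=
    PresentedGroup.one_of_mem ⟨x, y, X.L x y, X.R y x, rfl, rfl⟩
  rw [map_mul, map_inv, mul_inv_eq_one, map_mul, map_mul] at h
  exact h

/-- The universal property of `G(X, r)`. -/
def YBGroup.lift {X : Solution.{u}} {H : Type*} [Group H] (f : X.carrier → H)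
    (hf : ∀ x y, f x * f y = f (X.L x y) * f (X.R y x)) : X.YBGroup →* H :=
  PresentedGroup.toGroup (f := f) (by
    rintro _ ⟨x, y, z, t, h, rfl⟩
    rw [r_eq, Prod.mk.injEq] at h
    obtain ⟨rfl, rfl⟩ := h
    simp only [map_mul, map_inv, FreeGroup.lift_apply_of]
    rw [hf x y, mul_inv_cancel])

@[simp] theorem YBGroup.lift_ι {X : Solution.{u}} {H : Type*} [Group H] (f : X.carrier → H)
    (hf : ∀ x y, f x * f y = f (X.L x y) * f (X.R y x)) (x : X.carrier) :
    YBGroup.lift f hf (X.ι x) = f x :=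
  PresentedGroup.toGroup.of _

variable {X} in
theorem YBGroup.closure_ι : Subgroup.closure (Set.range X.ι) = ⊤ :=
  PresentedGroup.closure_range_of _

/-- The canonical left action `G(X, r) → Sym(X)`, extending `x ↦ L_x`. -/
noncomputable def act : X.YBGroup →* Equiv.Perm X.carrier := YBGroup.lift X.L L_mul

/-- The action of `Sym(X)` by permuting coordinates on the free abelian group on `X`. -/
noncomputable def permAct : Equiv.Perm X.carrier →* MulAut (Multiplicative (X.carrier →₀ ℤ)) where
  toFun s := AddEquiv.toMultiplicative (Finsupp.domCongr s)
  map_one' := by ext; rfl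
  map_mul' _ _ := by ext; rfl

/-- The homomorphism `G(X, r) → ℤ^(X) ⋊ Sym(X)` with `x ↦ (δ_x, L_x)`. -/
noncomputable def cocycleHom :
    X.YBGroup →* Multiplicative (X.carrier →₀ ℤ) ⋊[X.permAct] Equiv.Perm X.carrier :=
  YBGroup.lift (fun x => ⟨Multiplicative.ofAdd (Finsupp.single x 1), X.L x⟩) fun x y => by
    refine SemidirectProduct.ext ?_ (L_mul x y)
    apply Multiplicative.toAdd.injective
    change Finsupp.single x (1 : ℤ) + Finsupp.domCongr (X.L x) (Finsupp.single y 1)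
      = Finsupp.single (X.L x y) (1 : ℤ)
        + Finsupp.domCongr (X.L (X.L x y)) (Finsupp.single (X.R y x) 1)
    simp only [Finsupp.domCongr_apply, Finsupp.equivMapDomain_single, L_L_R]
    rw [add_comm]

/-- The bijective 1-cocycle `G(X, r) → ℤ^(X)` extending `x ↦ δ_x`. -/
noncomputable def coc (g : X.YBGroup) : X.carrier →₀ ℤ :=
  Multiplicative.toAdd (X.cocycleHom g).left

variable {X}

theorem act_ι (x : X.carrier) : X.act (X.ι x) = X.L x := YBGroup.lift_ι _ _ x

theorem cocycleHom_right (g : X.YBGroup) : (X.cocycleHom g).right = X.act g := by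
  suffices h : SemidirectProduct.rightHom.comp X.cocycleHom = X.act from DFunLike.congr_fun h g
  refine MonoidHom.eq_of_eqOn_dense YBGroup.closure_ι ?_
  rintro _ ⟨x, rfl⟩
  rw [act_ι, MonoidHom.comp_apply, cocycleHom, YBGroup.lift_ι]
  rfl

theorem coc_ι (x : X.carrier) : X.coc (X.ι x) = Finsupp.single x 1 := by
  rw [coc, cocycleHom, YBGroup.lift_ι]
  rfl

theorem coc_one : X.coc 1 = 0 := by
  rw [coc, map_one]
  rfl

theorem coc_mul (g h : X.YBGroup) :
    X.coc (g * h) = X.coc g + Finsupp.domCongr (X.act g) (X.coc h) := by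
  rw [coc, map_mul, SemidirectProduct.mul_left, cocycleHom_right]
  rfl

/-- The permutation `g ↦ g + x = g · (g⁻¹ x)` of `G(X, r)`, for `x ∈ X`. -/
noncomputable def trans (x : X.carrier) : Equiv.Perm X.YBGroup where
  toFun g := g * X.ι ((X.act g)⁻¹ x)
  invFun h := h * (X.ι (X.T⁻¹ ((X.act h)⁻¹ x)))⁻¹
  left_inv g := by
    set z := (X.act g)⁻¹ x with hz
    have h : (X.act (g * X.ι z))⁻¹ x = X.T z := by
      rw [map_mul, act_ι, mul_inv_rev, Equiv.Perm.mul_apply, ← hz]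
      rfl
    change g * X.ι z * (X.ι (X.T⁻¹ ((X.act (g * X.ι z))⁻¹ x)))⁻¹ = g
    rw [h, inv_apply_perm, mul_inv_cancel_right]
  right_inv h := by
    set z := X.T⁻¹ ((X.act h)⁻¹ x) with hz
    have h2 : (X.act (h * (X.ι z)⁻¹))⁻¹ x = z := by
      have h3 : X.T z = (X.act h)⁻¹ x := apply_inv_perm _ _
      rw [map_mul, map_inv, act_ι, mul_inv_rev, inv_inv, Equiv.Perm.mul_apply, ← h3]
      exact apply_inv_perm (X.L z) z
    change h * (X.ι z)⁻¹ * X.ι ((X.act (h * (X.ι z)⁻¹))⁻¹ x) = h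
    rw [h2, inv_mul_cancel_right]

theorem trans_apply (x : X.carrier) (g : X.YBGroup) :
    trans x g = g * X.ι ((X.act g)⁻¹ x) := rfl

theorem trans_comm (x y : X.carrier) : trans x * trans y = trans (X := X) y * trans x := by
  ext g
  simp only [Equiv.Perm.mul_apply, trans_apply, map_mul, act_ι, mul_inv_rev, mul_assoc]
  congr 1
  set u := (X.act g)⁻¹ x
  set v := (X.act g)⁻¹ y
  rw [X.ι_mul v, R_eq, apply_inv_perm]

theorem coc_trans (x : X.carrier) (g : X.YBGroup) :
    X.coc (trans x g) = X.coc g + Finsupp.single x 1 := by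
  rw [trans_apply, coc_mul, coc_ι, Finsupp.domCongr_apply, Finsupp.equivMapDomain_single,
    apply_inv_perm]

theorem coc_trans_inv (x : X.carrier) (g : X.YBGroup) :
    X.coc ((trans x)⁻¹ g) = X.coc g - Finsupp.single x 1 := by
  rw [eq_sub_iff_add_eq, ← coc_trans, apply_inv_perm]

/-- The (abelian) group of permutations of `G(X, r)` generated by the maps `g ↦ g + x`. -/
def transGroup (X : Solution.{u}) : Subgroup (Equiv.Perm X.YBGroup) :=
  Subgroup.closure (Set.range trans)

instance instCommGroupTrans (X : Solution.{u}) : CommGroup X.transGroup where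
  mul_comm :=
    haveI : IsMulCommutative X.transGroup := Subgroup.isMulCommutative_closure (by
      rintro _ ⟨x, rfl⟩ _ ⟨y, rfl⟩
      exact trans_comm x y)
    mul_comm'

/-- The action of `ℤ^(X)` on `G(X, r)` by translations. -/
noncomputable def transHom (X : Solution.{u}) : (X.carrier →₀ ℤ) →+ Additive X.transGroup :=
  Finsupp.liftAddHom fun x => zmultiplesHom _ (Additive.ofMul
    (⟨trans x, Subgroup.subset_closure ⟨x, rfl⟩⟩ : X.transGroup))

/-- The inverse of the 1-cocycle. -/
noncomputable def cocInv (a : X.carrier →₀ ℤ) : X.YBGroup :=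
  (X.transHom a).toMul.1 1

theorem cocInv_add (a : X.carrier →₀ ℤ) (x : X.carrier) :
    cocInv (a + Finsupp.single x 1) = trans x (cocInv a) := by
  rw [cocInv, add_comm, map_add, transHom, Finsupp.liftAddHom_apply_single, zmultiplesHom_apply,
    one_zsmul]
  rfl

theorem cocInv_sub (a : X.carrier →₀ ℤ) (x : X.carrier) :
    cocInv (a - Finsupp.single x 1) = (trans x)⁻¹ (cocInv a) := by
  rw [Equiv.Perm.eq_inv_iff_eq, ← cocInv_add, sub_add_cancel]

theorem cocInv_coc (g : X.YBGroup) : cocInv (X.coc g) = g := by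
  have hg : g ∈ Subgroup.closure (Set.range X.ι) := by
    rw [YBGroup.closure_ι]
    trivial
  induction hg using Subgroup.closure_induction_right with
  | one =>
    rw [coc_one, cocInv, map_zero]
    rfl
  | mul_right g _ y hy ih =>
    obtain ⟨z, rfl⟩ := hy
    have h : g * X.ι z = trans (X.act g z) g := by
      rw [trans_apply, inv_apply_perm]
    rw [h, coc_trans, cocInv_add, ih]
  | mul_inv_cancel g _ y hy ih =>
    obtain ⟨z, rfl⟩ := hy
    have h : g * (X.ι z)⁻¹ = (trans (X.act (g * (X.ι z)⁻¹) z))⁻¹ g := by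
      rw [Equiv.Perm.eq_inv_iff_eq, trans_apply, inv_apply_perm, inv_mul_cancel_right]
    rw [h, coc_trans_inv, cocInv_sub, ih]

theorem coc_cocInv (a : X.carrier →₀ ℤ) : X.coc (cocInv a) = a := by
  suffices h : ∀ g : X.YBGroup, X.coc ((X.transHom a).toMul.1 g) = X.coc g + a by
    rw [cocInv, h, coc_one, zero_add]
  have step : ∀ x g, (X.transHom (Finsupp.single x 1)).toMul.1 g = trans x g := fun x g => by
    rw [transHom, Finsupp.liftAddHom_apply_single, zmultiplesHom_apply, one_zsmul]
    rfl
  induction a using Finsupp.induction_linear with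
  | zero =>
    intro g
    rw [map_zero, add_zero]
    rfl
  | add a b iha ihb =>
    intro g
    rw [map_add, add_comm a b, ← add_assoc, ← ihb, ← iha]
    rfl
  | single x n =>
    induction n using Int.induction_on with
    | zero =>
      intro g
      rw [Finsupp.single_zero, map_zero, add_zero]
      rfl
    | succ n ih =>
      intro g
      rw [Finsupp.single_add, add_comm, map_add, add_comm _ (Finsupp.single x (n : ℤ)),
        ← add_assoc, ← ih, ← coc_trans, ← step]
      rfl
    | pred n ih =>
      intro g
      rw [Finsupp.single_sub, ← add_sub_assoc, ← ih, ← coc_trans_inv]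
      congr 1
      rw [Equiv.Perm.eq_inv_iff_eq, ← step, map_sub]
      change ((X.transHom (Finsupp.single x 1)
        + (X.transHom (Finsupp.single x (-n : ℤ)) - X.transHom (Finsupp.single x 1))).toMul).1 g = _
      rw [add_sub_cancel]

/-- The left action of `G(X, r)` upon itself: in terms of the bijection `G(X, r) ≃ ℤ^(X)` given
by the cocycle, `a` acts by permuting coordinates through `G(X, r) → Sym(X)`. -/
noncomputable def leftG (a b : X.YBGroup) : X.YBGroup :=
  cocInv (Finsupp.domCongr (X.act a) (X.coc b))

theorem coc_leftG (a b : X.YBGroup) :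
    X.coc (leftG a b) = Finsupp.domCongr (X.act a) (X.coc b) := coc_cocInv _

theorem coc_injective : Function.Injective X.coc := Function.LeftInverse.injective cocInv_coc

theorem domCongr_mul (s t : Equiv.Perm X.carrier) (a : X.carrier →₀ ℤ) :
    Finsupp.domCongr (s * t) a = Finsupp.domCongr s (Finsupp.domCongr t a) := by
  ext; rfl

theorem leftG_mul (a b c : X.YBGroup) : leftG (a * b) c = leftG a (leftG b c) := by
  apply coc_injective
  rw [coc_leftG, coc_leftG, coc_leftG, map_mul, domCongr_mul]

theorem leftG_mul_left (a u v : X.YBGroup) :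
    leftG a (u * v) = leftG a u * leftG ((leftG a u)⁻¹ * a * u) v := by
  apply coc_injective
  rw [coc_leftG, coc_mul, coc_mul, coc_leftG, coc_leftG, ← domCongr_mul, ← map_mul, map_add,
    ← domCongr_mul, ← map_mul, mul_assoc, mul_inv_cancel_left]

theorem leftG_leftG (a b : X.YBGroup) : leftG (leftG a b) ((leftG a b)⁻¹ * a * b) = a := by
  apply coc_injective
  have h := coc_mul (leftG a b) ((leftG a b)⁻¹ * a * b)
  have h1 : leftG a b * ((leftG a b)⁻¹ * a * b) = a * b := by group
  rw [h1, coc_mul, ← coc_leftG, add_comm, add_right_inj] at h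
  rw [coc_leftG, h]

theorem leftG_one (a : X.YBGroup) : leftG a 1 = 1 := by
  apply coc_injective
  rw [coc_leftG, coc_one, map_zero]

theorem one_leftG (a : X.YBGroup) : leftG 1 a = a := by
  apply coc_injective
  rw [coc_leftG, map_one]
  ext; rfl

/-- The symmetric group `(G, r_G)` associated to `(X, r)`: the group `G = G(X, r)` with the
unique involutive braiding operator `r_G` such that `r_G ∘ (ι × ι) = (ι × ι) ∘ r`; see
`symmetricGroup_ι` and `symmetricGroup_unique`. -/
noncomputable def symmetricGroup (X : Solution.{u}) : SymmetricGroup.{u} where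
  carrier := X.YBGroup
  group := inferInstance
  σ p := (leftG p.1 p.2, (leftG p.1 p.2)⁻¹ * p.1 * p.2)
  ML0 a u := ⟨leftG_one a, one_leftG u⟩
  MR0 a u := by simp [leftG_one, one_leftG]
  ML1 := leftG_mul
  MR1 a u v := by
    simp only [leftG_mul_left]
    group
  ML2 := leftG_mul_left
  MR2 a b u := by
    simp only [leftG_mul]
    group
  M3 u v := by group
  involutive p := by
    simp only [leftG_leftG]
    exact Prod.ext rfl (by group)

theorem symmetricGroup_ι (x y : X.carrier) :
    X.symmetricGroup.σ (X.ι x, X.ι y) = (X.ι (X.r (x, y)).1, X.ι (X.r (x, y)).2) := by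
  have h : leftG (X.ι x) (X.ι y) = X.ι (X.L x y) := by
    apply coc_injective
    rw [coc_leftG, coc_ι, coc_ι, act_ι, Finsupp.domCongr_apply, Finsupp.equivMapDomain_single]
  refine Prod.ext h ?_
  change (leftG (X.ι x) (X.ι y))⁻¹ * X.ι x * X.ι y = X.ι (X.R y x)
  rw [h, mul_assoc, ι_mul, inv_mul_cancel_left]

/-- Any homomorphism from `G(X, r)` to a symmetric group that is compatible with the braidings on
`X` is compatible with them on `G(X, r)`. In particular `r_G` is determined by `r`. -/
theorem symmetricGroup_unique (H : SymmetricGroup.{u}) (f : X.YBGroup →* H.carrier)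
    (hf : ∀ x y, H.σ (f (X.ι x), f (X.ι y)) = (f (X.ι (X.r (x, y)).1), f (X.ι (X.r (x, y)).2)))
    (a b : X.YBGroup) :
    H.σ (f a, f b) = (f (X.symmetricGroup.σ (a, b)).1, f (X.symmetricGroup.σ (a, b)).2) := by
  have hl : ∀ x y, H.left (f (X.ι x)) (f (X.ι y)) = f (X.ι (X.L x y)) := fun x y =>
    congrArg Prod.fst (hf x y)
  have hr : ∀ x y, H.right (f (X.ι x)) (f (X.ι y)) = f (X.ι (X.R y x)) := fun x y =>
    congrArg Prod.snd (hf x y)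
  have gl : ∀ x y, leftG (X.ι x) (X.ι y) = X.ι (X.L x y) := fun x y =>
    congrArg Prod.fst (symmetricGroup_ι x y)
  have gr : ∀ x y, (leftG (X.ι x) (X.ι y))⁻¹ * X.ι x * X.ι y = X.ι (X.R y x) := fun x y =>
    congrArg Prod.snd (symmetricGroup_ι x y)
  have hmul : ∀ x y c, H.left (f (X.ι x)) (f (X.ι y * c))
      = f (X.ι (X.L x y)) * H.left (f (X.ι (X.R y x))) (f c) := fun x y c => by
    rw [map_mul, SymmetricGroup.left_mul_left, hl, hr]
  have gmul : ∀ x y c, leftG (X.ι x) (X.ι y * c)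
      = X.ι (X.L x y) * leftG (X.ι (X.R y x)) c := fun x y c => by
    rw [leftG_mul_left, gr, gl]
  have top : ∀ g : X.YBGroup, g ∈ Subgroup.closure (Set.range X.ι) := fun g => by
    rw [YBGroup.closure_ι]
    trivial
  have gen : ∀ c x, H.left (f (X.ι x)) (f c) = f (leftG (X.ι x) c) := fun c => by
    induction top c using Subgroup.closure_induction_left with
    | one =>
      intro x
      rw [map_one, SymmetricGroup.left_one, leftG_one, map_one]
    | mul_left y hy c _ ih =>
      obtain ⟨y, rfl⟩ := hy
      intro x
      rw [hmul, gmul, ih, map_mul]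
    | inv_mul_cancel y hy c _ ih =>
      obtain ⟨y, rfl⟩ := hy
      intro x
      obtain ⟨x, rfl⟩ := (X.R y).surjective x
      have h1 := hmul x y ((X.ι y)⁻¹ * c)
      have h2 := gmul x y ((X.ι y)⁻¹ * c)
      rw [mul_inv_cancel_left] at h1 h2
      rw [ih, h2, map_mul] at h1
      exact (mul_left_cancel h1).symm
  have all : ∀ a b, H.left (f a) (f b) = f (leftG a b) := fun a => by
    induction top a using Subgroup.closure_induction_left with
    | one =>
      intro b
      rw [map_one, SymmetricGroup.one_left, one_leftG]
    | mul_left y hy c _ ih =>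
      obtain ⟨y, rfl⟩ := hy
      intro b
      rw [map_mul, SymmetricGroup.left_mul, ih, gen, leftG_mul]
    | inv_mul_cancel y hy c _ ih =>
      obtain ⟨y, rfl⟩ := hy
      intro b
      have h := gen (leftG ((X.ι y)⁻¹ * c) b) y
      rw [← leftG_mul, mul_inv_cancel_left, ← ih] at h
      rw [map_mul, map_inv, SymmetricGroup.left_mul, ← h, SymmetricGroup.left_inv_left]
  have hM := SymmetricGroup.mul_eq (f a) (f b)
  rw [all] at hM
  refine Prod.ext (all a b) ?_
  change H.right (f a) (f b) = f ((leftG a b)⁻¹ * a * b)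
  rw [map_mul, map_mul, map_inv, mul_assoc, ← hM, inv_mul_cancel_left]

end Solution

end YBE

namespace YBE

namespace Solution

variable {X : Solution.{u}}

/-! Everything is read off in coordinates. The bijective cocycle `coc` identifies `G` with the free
abelian group on `X`: it carries brace addition to addition, and the left action of `a` becomes the
permutation `act a` of the basis. The right action also permutes coordinates, but by the inverse of
`act (leftG a b)` (`coc_rightG`), a permutation depending on the element acted upon.

All six conditions amount to `ActInvariant`: `act (leftG a b) = act b`. On generators it says that
`Ret X` is trivial, which for nontrivial square-free `X` means level 2 (`hasMpl_two_iff`,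
`actInvariant_iff_L`). In `G` it says that `Ret G` is trivial. The rule for `ᵃ(bc)` links it to
actions by automorphisms. Invariance makes `a ↦ aᶜ` the fixed linear map of `(act c)⁻¹`, which gives
**Raut**. **Raut** implies **lri** because an additive map is determined on the basis. **lri**
implies invariance by testing it on `y * x ^ n`, where the multiplicity `n ≥ 2` singles out one
coordinate (`actInvariant_of_lri`).

For (2), level `n + 2` of `X` is level 2 of its `n`-th retraction, which is again square-free, and
nontriviality is noncommutativity of the group. -/

theorem isTrivial_iff : X.IsTrivial ↔ ∀ x, X.L x = 1 := by
  constructor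
  · intro h x
    ext y
    exact congrArg Prod.fst (h x y)
  · intro h x y
    rw [r_eq, R_eq, h, h]
    rfl

/-! ### Retractions and the multipermutation level -/

theorem subsingleton_ret_iff : Subsingleton X.Ret.carrier ↔ ∀ x y, X.L x = X.L y := by
  constructor
  · intro h x y
    exact Quotient.exact (h.elim (⟦x⟧ : Quotient X.retSetoid) ⟦y⟧)
  · intro h
    refine ⟨?_⟩
    rintro ⟨x⟩ ⟨y⟩
    exact Quotient.sound (h x y)

theorem subsingleton_ret_of_subsingleton (h : Subsingleton X.carrier) :
    Subsingleton X.Ret.carrier :=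
  subsingleton_ret_iff.2 fun _ _ => congrArg X.L (h.elim _ _)

theorem ret_isTrivial_iff : X.Ret.IsTrivial ↔ ∀ x y, X.L (X.L x y) = X.L y := by
  rw [isTrivial_iff]
  constructor
  · intro h x y
    exact Quotient.exact (DFunLike.congr_fun (h ⟦x⟧) ⟦y⟧)
  · rintro h ⟨x⟩
    ext ⟨y⟩
    exact Quotient.sound (h x y)

theorem IsSquareFree.L_self (h : X.IsSquareFree) (x : X.carrier) : X.L x x = x :=
  congrArg Prod.fst (h x)

theorem IsSquareFree.ret (h : X.IsSquareFree) : X.Ret.IsSquareFree := by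
  rintro ⟨x⟩
  exact congrArg (fun p : X.carrier × X.carrier =>
    ((⟦p.1⟧ : Quotient X.retSetoid), (⟦p.2⟧ : Quotient X.retSetoid))) (h x)

theorem IsSquareFree.iterate_ret (h : X.IsSquareFree) (n : ℕ) : (Ret^[n] X).IsSquareFree := by
  induction n with
  | zero => exact h
  | succ n ih =>
    rw [Function.iterate_succ_apply']
    exact ih.ret

/-- If all the `L` coincide, then `L x y = L y y = y`. -/
theorem IsSquareFree.subsingleton_ret_iff_isTrivial (h : X.IsSquareFree) :
    Subsingleton X.Ret.carrier ↔ X.IsTrivial := by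
  rw [subsingleton_ret_iff, isTrivial_iff]
  constructor
  · intro h2 x
    ext y
    rw [h2 x y, h.L_self]
    rfl
  · intro h2 x y
    rw [h2, h2]

theorem subsingleton_iterate_ret_mono {m n : ℕ} (hmn : m ≤ n)
    (h : Subsingleton (Ret^[m] X).carrier) : Subsingleton (Ret^[n] X).carrier := by
  induction n, hmn using Nat.le_induction with
  | base => exact h
  | succ n _ ih =>
    rw [Function.iterate_succ_apply']
    exact subsingleton_ret_of_subsingleton ih

/-- One-element solutions retract to one-element solutions, so minimality only has to be tested one
step below. -/
theorem hasMpl_succ_iff (n : ℕ) : X.HasMpl (n + 1) ↔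
    Subsingleton (Ret^[n + 1] X).carrier ∧ ¬ Subsingleton (Ret^[n] X).carrier := by
  constructor
  · rintro ⟨h1, h2⟩
    exact ⟨h1, fun h => absurd (h2 h) (by omega)⟩
  · rintro ⟨h1, h2⟩
    refine ⟨h1, fun k hk => ?_⟩
    by_contra! hlt
    exact h2 (subsingleton_iterate_ret_mono (by omega) hk)

theorem hasMpl_add_two_iff (n : ℕ) : X.HasMpl (n + 2) ↔ (Ret^[n] X).HasMpl 2 := by
  rw [hasMpl_succ_iff (n + 1), hasMpl_succ_iff 1, ← Function.iterate_add_apply,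
    ← Function.iterate_add_apply, add_comm n 1, add_comm (1 + 1) n, add_comm 1 n]

/-- Nontriviality already excludes levels 0 and 1, so only triviality of `Ret X` remains. -/
theorem IsSquareFree.hasMpl_two_iff (h : X.IsSquareFree) (hnt : ¬ X.IsTrivial) :
    X.HasMpl 2 ↔ ∀ x y, X.L (X.L x y) = X.L y := by
  rw [hasMpl_succ_iff 1, ← ret_isTrivial_iff, ← h.ret.subsingleton_ret_iff_isTrivial]
  exact and_iff_left fun h2 => hnt (h.subsingleton_ret_iff_isTrivial.1 h2)

theorem lri_iff : X.Lri ↔ ∀ x y, X.L x (X.R x y) = y := by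
  refine ⟨fun h x y => (h x y).2, fun h x y => ⟨?_, h x y⟩⟩
  apply (X.L x).injective
  rw [h]

/-! ### The symmetric group `G(X, r)` -/

theorem YBGroup.mem_closure_ι (g : X.YBGroup) : g ∈ Subgroup.closure (Set.range X.ι) := by
  rw [YBGroup.closure_ι]
  trivial

theorem leftG_ι (a : X.YBGroup) (x : X.carrier) : leftG a (X.ι x) = X.ι (X.act a x) := by
  apply coc_injective
  rw [coc_leftG, coc_ι, coc_ι, Finsupp.domCongr_apply, Finsupp.equivMapDomain_single]

theorem single_one_injective :
    Function.Injective fun x : X.carrier => (Finsupp.single x 1 : X.carrier →₀ ℤ) :=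
  Finsupp.single_left_injective one_ne_zero

theorem ι_injective : Function.Injective X.ι := fun x y h => by
  apply single_one_injective
  change Finsupp.single x (1 : ℤ) = Finsupp.single y 1
  rw [← coc_ι, ← coc_ι, h]

/-- `X` embeds in `G` as the basis, so the action on `G` and the permutation of `X` determine each
other. -/
theorem leftG_eq_iff {a b : X.YBGroup} : leftG a = leftG b ↔ X.act a = X.act b := by
  constructor
  · intro h
    ext x
    apply ι_injective
    rw [← leftG_ι, ← leftG_ι, h]
  · intro h
    funext c
    rw [leftG, leftG, h]

theorem symmetricGroup_L_eq_iff {a b : X.YBGroup} :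
    X.symmetricGroup.toSolution.L a = X.symmetricGroup.toSolution.L b ↔ X.act a = X.act b := by
  rw [← leftG_eq_iff]
  exact ⟨fun h => funext fun c => DFunLike.congr_fun h c,
    fun h => Equiv.ext fun c => congrFun h c⟩

theorem symmetricGroup_L_one : X.symmetricGroup.toSolution.L (1 : X.YBGroup) = 1 :=
  Equiv.ext fun c => one_leftG c

theorem domCongr_one (a : X.carrier →₀ ℤ) :
    Finsupp.domCongr (1 : Equiv.Perm X.carrier) a = a := by
  ext; rfl

/-- The right action of `G(X, r)` upon itself. -/
noncomputable def rightG (a b : X.YBGroup) : X.YBGroup := (leftG a b)⁻¹ * a * b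

theorem leftG_mul_rightG (a b : X.YBGroup) : leftG a b * rightG a b = a * b := by
  rw [rightG, mul_assoc, mul_inv_cancel_left]

theorem leftG_mul_left' (a b c : X.YBGroup) :
    leftG a (b * c) = leftG a b * leftG (rightG a b) c := leftG_mul_left a b c

theorem leftG_leftG_rightG (a b : X.YBGroup) : leftG (leftG a b) (rightG a b) = a :=
  leftG_leftG a b

theorem rightG_surjective (b : X.YBGroup) : Function.Surjective fun a => rightG a b :=
  (X.symmetricGroup.toSolution.right_bijective b).surjective

/-- Apply `coc` to the involutivity identity `leftG_leftG_rightG` and solve for the right factor. -/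
theorem coc_rightG (a b : X.YBGroup) :
    X.coc (rightG a b) = Finsupp.domCongr (X.act (leftG a b))⁻¹ (X.coc a) := by
  have h := congrArg X.coc (leftG_leftG_rightG a b)
  rw [coc_leftG] at h
  conv_rhs => rw [← h]
  rw [← domCongr_mul, inv_mul_cancel, domCongr_one]

/-- The addition of the left brace associated to `G(X, r)`. -/
noncomputable def addG (a b : X.YBGroup) : X.YBGroup := a * leftG a⁻¹ b

theorem coc_addG (a b : X.YBGroup) : X.coc (addG a b) = X.coc a + X.coc b := by
  rw [addG, coc_mul, coc_leftG, ← domCongr_mul, ← map_mul, mul_inv_cancel, map_one,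
    domCongr_one]

theorem symmetricGroup_mlaut_iff : X.symmetricGroup.MLaut ↔
    ∀ a b c : X.YBGroup, leftG a (b * c) = leftG a b * leftG a c := Iff.rfl

theorem symmetricGroup_raut_iff : X.symmetricGroup.Raut ↔
    ∀ a b c : X.YBGroup, rightG (addG a b) c = addG (rightG a c) (rightG b c) := Iff.rfl

/-- Square-freeness means that `x` fixes its own basis vector, so multiplicative powers are additive
multiples. -/
theorem IsSquareFree.coc_ι_pow (h : X.IsSquareFree) (x : X.carrier) (n : ℕ) :
    X.coc (X.ι x ^ n) = Finsupp.single x (n : ℤ) := by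
  induction n with
  | zero => simp [coc_one]
  | succ n ih =>
    rw [pow_succ', coc_mul, ih, act_ι, coc_ι, Finsupp.domCongr_apply,
      Finsupp.equivMapDomain_single, h.L_self, ← Finsupp.single_add]
    congr 1
    push_cast
    ring

/-! ### Invariance of the action, and actions by automorphisms -/

/-- The action of `G(X, r)` on `X` is invariant under the left action of `G(X, r)` on itself. -/
def ActInvariant (X : Solution.{u}) : Prop := ∀ a b : X.YBGroup, X.act (leftG a b) = X.act b

theorem actInvariant_of_ι (h : ∀ x (b : X.YBGroup), X.act (leftG (X.ι x) b) = X.act b) :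
    X.ActInvariant := by
  intro a
  induction YBGroup.mem_closure_ι a using Subgroup.closure_induction_left with
  | one =>
    intro b
    rw [one_leftG]
  | mul_left y hy c _ ih =>
    obtain ⟨y, rfl⟩ := hy
    intro b
    rw [leftG_mul, h, ih]
  | inv_mul_cancel y hy c _ ih =>
    obtain ⟨y, rfl⟩ := hy
    intro b
    rw [← h y, ← leftG_mul, mul_inv_cancel_left, ih]

/-- Invariance spreads from generators in two stages: first to all acting elements, then to all
elements acted upon. The second induction keeps `a` general because splitting `yc` replaces `a` by
its right translate under `y`. -/
theorem actInvariant_iff_L : X.ActInvariant ↔ ∀ x y, X.L (X.L x y) = X.L y := by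
  constructor
  · intro h x y
    have := h (X.ι x) (X.ι y)
    rwa [leftG_ι, act_ι, act_ι, act_ι] at this
  · intro h
    suffices h2 : ∀ b a : X.YBGroup, X.act (leftG a b) = X.act b from fun a b => h2 b a
    have gen : ∀ (a : X.YBGroup) y, X.L (X.act a y) = X.L y := by
      intro a
      induction YBGroup.mem_closure_ι a using Subgroup.closure_induction_left with
      | one =>
        intro y
        rw [map_one]
        rfl
      | mul_left x hx c _ ih =>
        obtain ⟨x, rfl⟩ := hx
        intro y
        rw [map_mul, Equiv.Perm.mul_apply, act_ι, h, ih]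
      | inv_mul_cancel x hx c _ ih =>
        obtain ⟨x, rfl⟩ := hx
        intro y
        rw [map_mul, Equiv.Perm.mul_apply, map_inv, act_ι, ← h x, apply_inv_perm, ih]
    intro b
    induction YBGroup.mem_closure_ι b using Subgroup.closure_induction_left with
    | one =>
      intro a
      rw [leftG_one]
    | mul_left y hy c _ ih =>
      obtain ⟨y, rfl⟩ := hy
      intro a
      rw [leftG_mul_left, map_mul, ih, leftG_ι, act_ι, gen, map_mul, act_ι]
    | inv_mul_cancel y hy c _ ih =>
      obtain ⟨y, rfl⟩ := hy
      intro a
      -- Writing the acting element as a right translate under `y` lets the product rule for `y *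
      -- (y⁻¹ * c)` be read backwards.
      obtain ⟨a, rfl⟩ := rightG_surjective (X.ι y) a
      have h2 := leftG_mul_left' a (X.ι y) ((X.ι y)⁻¹ * c)
      rw [mul_inv_cancel_left] at h2
      have h3 := congrArg X.act h2
      rw [ih, map_mul, leftG_ι, act_ι, gen] at h3
      rw [map_mul, map_inv, h3, act_ι, inv_mul_cancel_left]

theorem actInvariant_iff_left : X.ActInvariant ↔
    ∀ a b : X.symmetricGroup.carrier,
      X.symmetricGroup.left (X.symmetricGroup.left b a) = X.symmetricGroup.left a :=
  ⟨fun h a b => leftG_eq_iff.2 (h b a), fun h a b => leftG_eq_iff.1 (h b a)⟩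

theorem ActInvariant.act_rightG (h : X.ActInvariant) (a b : X.YBGroup) :
    X.act (rightG a b) = X.act a := by
  rw [← h (leftG a b) (rightG a b), leftG_leftG_rightG]

/-- By the product rule, `a` acts by automorphisms exactly when each `aᵇ` acts as `a` does.
Involutivity of the braiding converts this right invariance into left invariance. -/
theorem actInvariant_iff_mlaut : X.ActInvariant ↔ X.symmetricGroup.MLaut := by
  rw [symmetricGroup_mlaut_iff]
  constructor
  · intro h a b c
    rw [leftG_mul_left', leftG_eq_iff.2 (h.act_rightG a b)]
  · intro h
    have key : ∀ a b : X.YBGroup, X.act (rightG a b) = X.act a := fun a b => by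
      refine leftG_eq_iff.1 (funext fun c => ?_)
      have h1 := h a b c
      rw [leftG_mul_left'] at h1
      exact mul_left_cancel h1
    intro a b
    -- By involutivity, the right component of the braiding at this pair is `b`.
    have h1 := key (leftG a b) (rightG a b)
    rw [rightG, leftG_leftG_rightG, mul_assoc, leftG_mul_rightG, inv_mul_cancel_left] at h1
    exact h1.symm

/-! ### The conditions **lri** and **Raut** -/

theorem symmetricGroup_lri_iff : X.symmetricGroup.toSolution.Lri ↔
    ∀ a b : X.YBGroup, Finsupp.domCongr (X.act (leftG a b))⁻¹ (X.coc a)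
      = Finsupp.domCongr (X.act b)⁻¹ (X.coc a) := by
  rw [lri_iff, forall_comm]
  suffices h : ∀ a b : X.YBGroup, leftG b (rightG a b) = a ↔
      Finsupp.domCongr (X.act (leftG a b))⁻¹ (X.coc a)
        = Finsupp.domCongr (X.act b)⁻¹ (X.coc a) from
    forall_congr' fun a => forall_congr' fun b => h a b
  intro a b
  rw [← coc_injective.eq_iff, coc_leftG, coc_rightG]
  constructor
  · intro h
    conv_rhs => rw [← h]
    rw [← domCongr_mul (X.act b)⁻¹, inv_mul_cancel, domCongr_one]
  · intro h
    rw [h, ← domCongr_mul, mul_inv_cancel, domCongr_one]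

theorem ActInvariant.raut (h : X.ActInvariant) : X.symmetricGroup.Raut := by
  rw [symmetricGroup_raut_iff]
  intro a b c
  apply coc_injective
  rw [coc_rightG, coc_addG, coc_addG, coc_rightG, coc_rightG, h, h, h, map_add]

/-- The coefficient at `b` is at least `n` on the left, while on the right it is at most 1 unless `b
= d`. For `n = 1` the two basis vectors could be swapped. -/
theorem eq_of_single_add_single_eq {A : Type*} {a b c d : A} {n : ℕ} (hn : 2 ≤ n)
    (h : Finsupp.single a (1 : ℤ) + Finsupp.single b (n : ℤ)
      = Finsupp.single c 1 + Finsupp.single d (n : ℤ)) : b = d := by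
  classical
  have h1 := DFunLike.congr_fun h b
  simp only [Finsupp.add_apply, Finsupp.single_apply, if_true] at h1
  by_contra hne
  rw [if_neg (Ne.symm hne)] at h1
  split_ifs at h1 <;> omega

/-- **lri** compares two permutations only on the vector of `a`. Taking `a = y * x ^ n`, with vector
`δ_y + n δ_(L y x)`, gives agreement at the point `L y x`, which is arbitrary as `x` varies. The
powers of `x` are then removed by comparing exponents. -/
theorem IsSquareFree.actInvariant_of_lri (hsf : X.IsSquareFree)
    (h : X.symmetricGroup.toSolution.Lri) : X.ActInvariant := by
  rw [symmetricGroup_lri_iff] at h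
  refine actInvariant_of_ι fun y z => inv_injective (Equiv.ext fun x => ?_)
  obtain ⟨x, rfl⟩ := (X.L y).surjective x
  have key : ∀ n, 2 ≤ n → ∀ z, (X.act (leftG (X.ι y * X.ι x ^ n) z))⁻¹ (X.L y x)
      = (X.act z)⁻¹ (X.L y x) := fun n hn z => by
    have h1 := h (X.ι y * X.ι x ^ n) z
    simp only [coc_mul, coc_ι, hsf.coc_ι_pow, act_ι, map_add, Finsupp.domCongr_apply,
      Finsupp.equivMapDomain_single] at h1
    exact eq_of_single_add_single_eq hn h1
  -- Exponent 2 applied to the translate of `z` by `x` is exponent 3 applied to `z`.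
  have step : ∀ z, (X.act (leftG (X.ι x) z))⁻¹ (X.L y x) = (X.act z)⁻¹ (X.L y x) := fun z => by
    rw [← key 2 le_rfl, ← leftG_mul, mul_assoc, ← pow_succ, key 3 (by norm_num)]
  -- The factor `x ^ 2` supplies the exponent needed after `y`, and two uses of `step` absorb it on
  -- the other side.
  obtain ⟨w, rfl⟩ : ∃ w, z = leftG (X.ι x ^ 2) w :=
    ⟨leftG (X.ι x ^ 2)⁻¹ z, by rw [← leftG_mul, mul_inv_cancel, one_leftG]⟩
  rw [← leftG_mul, key 2 le_rfl, pow_two, leftG_mul, step, step]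

/-- For fixed `c`, both `a ↦ aᶜ` and the action of `c⁻¹` are additive in coordinates, so it suffices
to compare them on basis vectors. There square-freeness decides, through `x + x = x * x`. -/
theorem IsSquareFree.lri_of_raut (hsf : X.IsSquareFree) (h : X.symmetricGroup.Raut) :
    X.symmetricGroup.toSolution.Lri := by
  rw [symmetricGroup_raut_iff] at h
  have hadd : ∀ a b c : X.YBGroup,
      Finsupp.domCongr (X.act (leftG (addG a b) c))⁻¹
          (X.coc a + X.coc b)
        = Finsupp.domCongr (X.act (leftG a c))⁻¹ (X.coc a)
          + Finsupp.domCongr (X.act (leftG b c))⁻¹ (X.coc b) := fun a b c => by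
    rw [← coc_addG, ← coc_rightG, ← coc_rightG, ← coc_rightG, ← coc_addG, h]
  -- Additivity at `x + x = x * x` gives twice a basis vector on each side. It compares translates
  -- of `c` by `x * x` and by `x`, so `c` is first written as a translate by `x`.
  have hx : ∀ x (c : X.YBGroup), (X.act (leftG (X.ι x) c))⁻¹ x = (X.act c)⁻¹ x := fun x c => by
    obtain ⟨c, rfl⟩ : ∃ w, c = leftG (X.ι x) w :=
      ⟨leftG (X.ι x)⁻¹ c, by rw [← leftG_mul, mul_inv_cancel, one_leftG]⟩
    have h1 := hadd (X.ι x) (X.ι x) c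
    have h2 : addG (X.ι x) (X.ι x) = X.ι x * X.ι x := by
      apply coc_injective
      rw [coc_addG, coc_mul, coc_ι, act_ι, Finsupp.domCongr_apply,
        Finsupp.equivMapDomain_single, hsf.L_self]
    rw [h2, coc_ι, ← Finsupp.single_add, Finsupp.domCongr_apply, Finsupp.domCongr_apply,
      Finsupp.equivMapDomain_single, Finsupp.equivMapDomain_single, ← Finsupp.single_add,
      leftG_mul] at h1
    exact Finsupp.single_left_injective (by norm_num) h1
  rw [symmetricGroup_lri_iff]
  intro a c
  let φ : (X.carrier →₀ ℤ) →+ (X.carrier →₀ ℤ) :=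
    AddMonoidHom.mk' (fun b => Finsupp.domCongr (X.act (leftG (cocInv b) c))⁻¹ b) fun a b => by
      have h1 := hadd (cocInv a) (cocInv b) c
      have h2 : addG (cocInv a) (cocInv b)
          = cocInv (a + b) := by
        apply coc_injective
        rw [coc_addG, coc_cocInv, coc_cocInv, coc_cocInv]
      rwa [h2, coc_cocInv, coc_cocInv] at h1
  have hφ : φ = (Finsupp.domCongr (X.act c)⁻¹ : (X.carrier →₀ ℤ) ≃+ _).toAddMonoidHom := by
    refine Finsupp.addHom_ext' fun x => AddMonoidHom.ext_int ?_
    change Finsupp.domCongr (X.act (leftG (cocInv (Finsupp.single x 1)) c))⁻¹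
        (Finsupp.single x 1) = Finsupp.domCongr (X.act c)⁻¹ (Finsupp.single x 1)
    rw [← coc_ι, cocInv_coc, coc_ι, Finsupp.domCongr_apply, Finsupp.domCongr_apply,
      Finsupp.equivMapDomain_single, Finsupp.equivMapDomain_single, hx]
  have h3 := DFunLike.congr_fun hφ (X.coc a)
  change Finsupp.domCongr (X.act (leftG (cocInv (X.coc a)) c))⁻¹ (X.coc a) = _ at h3
  rwa [cocInv_coc] at h3

/-! ### Trivial solutions, commutativity and the level of the symmetric group -/

theorem isTrivial_iff_act : X.IsTrivial ↔ ∀ a : X.YBGroup, X.act a = 1 := by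
  rw [isTrivial_iff]
  constructor
  · intro h a
    refine DFunLike.congr_fun (g := (1 : X.YBGroup →* _)) ?_ a
    refine MonoidHom.eq_of_eqOn_dense YBGroup.closure_ι ?_
    rintro _ ⟨x, rfl⟩
    rw [act_ι, h]
    rfl
  · intro h x
    rw [← act_ι, h]

theorem symmetricGroup_hasMpl_two_iff (hnt : ¬ X.IsTrivial) :
    X.symmetricGroup.toSolution.HasMpl 2 ↔ X.ActInvariant := by
  rw [hasMpl_succ_iff 1]
  have h1 : ¬ Subsingleton (Ret^[1] X.symmetricGroup.toSolution).carrier := by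
    intro h
    refine hnt (isTrivial_iff_act.2 fun a => ?_)
    rw [← map_one X.act]
    exact symmetricGroup_L_eq_iff.1 (subsingleton_ret_iff.1 h a (1 : X.YBGroup))
  rw [and_iff_left h1]
  change Subsingleton X.symmetricGroup.toSolution.Ret.Ret.carrier ↔ _
  have h2 : X.ActInvariant ↔ X.symmetricGroup.toSolution.Ret.IsTrivial := by
    rw [ret_isTrivial_iff]
    exact forall_congr' fun a => forall_congr' fun b => symmetricGroup_L_eq_iff.symm
  rw [h2, subsingleton_ret_iff, isTrivial_iff]
  constructor
  · intro h a
    -- The class of the identity acts trivially, so it takes over the role that square-freeness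
    -- plays for `X`.
    rw [h a (Quotient.mk X.symmetricGroup.toSolution.retSetoid (1 : X.YBGroup))]
    ext ⟨b⟩
    exact congrArg (Quotient.mk X.symmetricGroup.toSolution.retSetoid)
      (DFunLike.congr_fun symmetricGroup_L_one b)
  · intro h a b
    rw [h, h]

/-- If `x` and `y` commute, then `δ_x + δ_(L x y) = δ_y + δ_(L y x)`. For `y ≠ x`, the coefficient
at `y` forces `L x y = y`; the diagonal case is square-freeness. -/
theorem IsSquareFree.isTrivial_iff_comm (hsf : X.IsSquareFree) :
    X.IsTrivial ↔ ∀ a b : X.YBGroup, a * b = b * a := by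
  constructor
  · intro h a b
    have ha := isTrivial_iff_act.1 h
    apply coc_injective
    rw [coc_mul, coc_mul, ha, ha, domCongr_one, domCongr_one, add_comm]
  · intro h
    refine isTrivial_iff.2 fun x => Equiv.ext fun y => ?_
    by_cases hxy : y = x
    · rw [hxy, hsf.L_self]
      rfl
    classical
    have h1 := congrArg X.coc (h (X.ι x) (X.ι y))
    simp only [coc_mul, coc_ι, act_ι, Finsupp.domCongr_apply, Finsupp.equivMapDomain_single] at h1
    have h2 := DFunLike.congr_fun h1 y
    simp only [Finsupp.add_apply, Finsupp.single_apply, if_true] at h2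
    rw [if_neg (Ne.symm hxy)] at h2
    change X.L x y = y
    by_contra hne
    rw [if_neg hne] at h2
    split_ifs at h2 <;> omega

/-! ### Assembly of the equivalences -/

theorem IsSquareFree.tfae (hsf : X.IsSquareFree) (hnt : ¬ X.IsTrivial) :
    [ X.HasMpl 2,
      X.symmetricGroup.toSolution.HasMpl 2,
      X.symmetricGroup.MLaut,
      ∀ a b : X.symmetricGroup.carrier,
        X.symmetricGroup.left (X.symmetricGroup.left b a) = X.symmetricGroup.left a,
      X.symmetricGroup.toSolution.Lri,
      X.symmetricGroup.Raut ].TFAE := by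
  rw [hsf.hasMpl_two_iff hnt, ← actInvariant_iff_L, symmetricGroup_hasMpl_two_iff hnt,
    ← actInvariant_iff_mlaut, ← actInvariant_iff_left]
  tfae_have 1 ↔ 2 := Iff.rfl
  tfae_have 1 ↔ 3 := Iff.rfl
  tfae_have 1 ↔ 4 := Iff.rfl
  tfae_have 1 → 6 := ActInvariant.raut
  tfae_have 6 → 5 := hsf.lri_of_raut
  tfae_have 5 → 1 := hsf.actInvariant_of_lri
  tfae_finish

theorem IsSquareFree.hasMpl_two_iff_lri (hsf : X.IsSquareFree) :
    X.HasMpl 2 ↔ (¬ ∀ a b : X.symmetricGroup.carrier, a * b = b * a) ∧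
      X.symmetricGroup.toSolution.Lri := by
  have hc : (∀ a b : X.symmetricGroup.carrier, a * b = b * a) ↔ X.IsTrivial :=
    hsf.isTrivial_iff_comm.symm
  rw [hc]
  by_cases hnt : X.IsTrivial
  -- A trivial square-free solution has a one-element retraction, so its level is below 2.
  · refine iff_of_false (fun h => ?_) fun h => h.1 hnt
    exact ((hasMpl_succ_iff 1).1 h).2 (hsf.subsingleton_ret_iff_isTrivial.2 hnt)
  · rw [and_iff_right hnt]
    exact (hsf.tfae hnt).out 0 4

end Solution

end YBE

theorem mainTheorem7 (X : YBE.Solution.{u}) (hsf : X.IsSquareFree) (hnt : ¬ X.IsTrivial) :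
    [ X.HasMpl 2,
      X.symmetricGroup.toSolution.HasMpl 2,
      X.symmetricGroup.MLaut,
      ∀ a b : X.symmetricGroup.carrier,
        X.symmetricGroup.left (X.symmetricGroup.left b a) = X.symmetricGroup.left a,
      X.symmetricGroup.toSolution.Lri,
      X.symmetricGroup.Raut ].TFAE ∧
    ∀ m : ℕ, 2 ≤ m →
      (X.HasMpl m ↔
        (¬ ∀ a b : (YBE.Solution.Ret^[m - 2] X).symmetricGroup.carrier, a * b = b * a) ∧
          (YBE.Solution.Ret^[m - 2] X).symmetricGroup.toSolution.Lri) := by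
  refine ⟨hsf.tfae hnt, fun m hm => ?_⟩
  obtain ⟨n, rfl⟩ := Nat.exists_eq_add_of_le' hm
  rw [Nat.add_sub_cancel, YBE.Solution.hasMpl_add_two_iff]
  exact (hsf.iterate_ret n).hasMpl_two_iff_lri
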